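/- For a set $M\subseteq\mathbb{R}^d$, let $\operatorname{Sym}(M):=\{A\in\operatorname{GL}(d):AM=M\}$, and let $\mathfrak{sym}(M)\subseteq\mathbb{R}^{d\times d}$ be its Lie algebra, that is, the set of all matrices $f'(0)$ where $f$ is a differentiable function from an open interval $I\ni 0$ to $\operatorname{Sym}(M)$ with $f(0)=\operatorname{id}$. For a smooth embedded submanifold $M$ of $\mathbb{R}^d$ and $x\in M$, let $T_xM$ be the tangent space of $M$ at $x$ (the set of velocities $f'(0)$ of differentiable curves $f\colon I\to M$ with $f(0)=x$), and put $S_xM:=\{A\in\mathbb{R}^{d\times d}:Ax\in T_xM\}$. Define \[ n^\star(M):=\frac{\operatorname{codim}\mathfrak{sym}(M)}{\operatorname{codim}M}, \] and let $n^\circ(M)\in\mathbb{N}\cup\{\infty\}$ be the infimum (with $\inf\emptyset=\infty$) of all $n\in\mathbb{N}$ for which there is a subset $O$ of $M^n$, open and dense in the subspace topology, such that $\mathfrak{sym}(M)=\bigcap_{i=1}^n S_{x_i}M$ for every $(x_1,\ldots,x_n)\in O$. **Theorem.** Let $Q$ be a real symmetric $d\times d$ matrix of full rank and put $M:=\{x\in\mathbb{R}^d\setminus\{0\}:x^\top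 Qx=0\}$. (a) $M$ is empty if and only if $Q$ is positive definite or negative definite. Suppose now that $Q$ is neither positive definite nor negative definite. Then $M$ is a smooth embedded submanifold of $\mathbb{R}^d$ of codimension $1$, and the following hold. (b) If $d=2$, then $n^\star(M)=2$ but $n^\circ(M)=\infty$. (c) If $d\neq 2$ (equivalently, $d\ge 3$), then $n^\circ(M)=n^\star(M)=\binom{d+1}{2}-1$. (d) For every $d$, $\mathfrak{sym}(M)=\{Z\in\mathbb{R}^{d\times d}:Z^\top Q+QZ=0\}+\mathbb{R}\operatorname{id}$. Moreover, there are $p,q\ge 1$ and an invertible matrix $P$ with $Q=P^\top I_{p,q}P$, where $I_{p,q}:=\operatorname{diag}(\mathbf{1}_p,-\mathbf{1}_q)$, and for all such $p$, $q$, $P$ one has \[ \mathfrak{sym}(M)=\{P^{-1}WP+\beta\operatorname{id}:W\in\mathfrak{o}(p,q),\ \beta\in\mathbb{R}\}, \] where $\mathfrak{o}(p,q)=\{W\in\mathbb{R}^{(p+q)\times(p+q)}:W^\top I_{p,q}+I_{p,q}W=0\}$. -/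

import Mathlib

open scoped ContDiff

/-! Real `d`-space is `Fin d → ℝ`: only its linear structure, its topology and derivatives are used
below, and these do not depend on the choice of a norm. -/

/-- The symmetry group of `M ⊆ ℝ^d`: all `A ∈ GL(d)` with `A M = M`. -/
def symGroup {d : ℕ} (M : Set (Fin d → ℝ)) : Subgroup (GL (Fin d) ℝ) where
  carrier := {A | (fun x => (A : Matrix (Fin d) (Fin d) ℝ).mulVec x) '' M = M}
  one_mem' := by simp
  mul_mem' := by
    intro A B hA hB
    simp only [Set.mem_ofPred_eq] at hA hB ⊢
    calc (fun x => ((A * B : GL (Fin d) ℝ) : Matrix (Fin d) (Fin d) ℝ).mulVec x) '' M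
        = (fun x => (A : Matrix (Fin d) (Fin d) ℝ).mulVec x) ''
            ((fun x => (B : Matrix (Fin d) (Fin d) ℝ).mulVec x) '' M) := by
          rw [Set.image_image]
          simp [Matrix.mulVec_mulVec]
      _ = M := by rw [hB, hA]
  inv_mem' := by
    intro A hA
    simp only [Set.mem_ofPred_eq] at hA ⊢
    conv_lhs => rw [← hA]
    rw [Set.image_image]
    simp only [Matrix.mulVec_mulVec]
    rw [← Units.val_mul, inv_mul_cancel]
    simp

/-- `IsSymVelocity M Z`: there is a differentiable curve `f` from an open interval around `0` to
`Sym(M)`, viewed as a set of matrices, with `f 0 = id` and `f' 0 = Z`. -/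
def IsSymVelocity {d : ℕ} (M : Set (Fin d → ℝ)) (Z : Matrix (Fin d) (Fin d) ℝ) : Prop :=
  ∃ ε : ℝ, 0 < ε ∧ ∃ f : ℝ → Matrix (Fin d) (Fin d) ℝ,
    (∀ t ∈ Set.Ioo (-ε) ε,
      (∃ A ∈ symGroup M, (A : Matrix (Fin d) (Fin d) ℝ) = f t) ∧ DifferentiableAt ℝ f t) ∧
    f 0 = 1 ∧ HasDerivAt f Z 0

/-- The Lie algebra `𝔰𝔶𝔪(M)` of the symmetry group: the set of all velocities at the identity of
differentiable curves in `Sym(M)`, which is a linear subspace of `ℝ^{d×d}`. -/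
def symAlg {d : ℕ} (M : Set (Fin d → ℝ)) : Submodule ℝ (Matrix (Fin d) (Fin d) ℝ) where
  carrier := {Z | IsSymVelocity M Z}
  zero_mem' := by
    let _ := Matrix.linftyOpNormedRing (n := Fin d) (α := ℝ)
    let _ := Matrix.linftyOpNormedAlgebra (R := ℝ) (n := Fin d) (α := ℝ)
    refine ⟨1, one_pos, fun _ => 1, fun t _ => ⟨⟨1, one_mem _, by simp⟩, ?_⟩, rfl, ?_⟩
    · exact differentiableAt_const (1 : Matrix (Fin d) (Fin d) ℝ)
    · exact hasDerivAt_const _ _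
  add_mem' := by
    rintro X Y ⟨ε, hε, f, hf, hf0, hfX⟩ ⟨δ, hδ, g, hg, hg0, hgY⟩
    let _ := Matrix.linftyOpNormedRing (n := Fin d) (α := ℝ)
    let _ := Matrix.linftyOpNormedAlgebra (R := ℝ) (n := Fin d) (α := ℝ)
    refine ⟨min ε δ, lt_min hε hδ, fun t => f t * g t, fun t ht => ?_, by simp [hf0, hg0], ?_⟩
    · have h1 := hf t ⟨by linarith [ht.1, min_le_left ε δ], ht.2.trans_le (min_le_left _ _)⟩
      have h2 := hg t ⟨by linarith [ht.1, min_le_right ε δ], ht.2.trans_le (min_le_right _ _)⟩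
      obtain ⟨⟨A, hA, hAf⟩, hfd⟩ := h1
      obtain ⟨⟨B, hB, hBg⟩, hgd⟩ := h2
      have h3 : HasDerivAt (fun s => f s * g s) (deriv f t * g t + f t * deriv g t) t :=
        hfd.hasDerivAt.mul hgd.hasDerivAt
      exact ⟨⟨A * B, mul_mem hA hB, by rw [Units.val_mul, hAf, hBg]⟩, h3.differentiableAt⟩
    · have h : HasDerivAt (fun s => f s * g s) (X * g 0 + f 0 * Y) 0 := hfX.mul hgY
      rw [hf0, hg0, mul_one, one_mul] at h
      exact h
  smul_mem' := by
    rintro c X ⟨ε, hε, f, hf, hf0, hfX⟩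
    let _ := Matrix.linftyOpNormedRing (n := Fin d) (α := ℝ)
    let _ := Matrix.linftyOpNormedAlgebra (R := ℝ) (n := Fin d) (α := ℝ)
    have hc : 0 < |c| + 1 := by positivity
    have hd (t : ℝ) : HasDerivAt (fun s : ℝ => c * s) c t := by
      simpa using (hasDerivAt_id t).const_mul c
    refine ⟨ε / (|c| + 1), by positivity, fun t => f (c * t), fun t ht => ?_, by simp [hf0], ?_⟩
    · have ht' : |c * t| < ε := by
        have h1 : |t| < ε / (|c| + 1) := abs_lt.2 ⟨ht.1, ht.2⟩
        rw [lt_div_iff₀ hc] at h1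
        rw [abs_mul]
        nlinarith [abs_nonneg t, abs_nonneg c]
      have h2 := hf (c * t) (abs_lt.1 ht')
      exact ⟨h2.1, (h2.2.hasDerivAt.scomp t (hd t)).differentiableAt⟩
    · have h0 : HasDerivAt f X (c * 0) := by simpa using hfX
      exact h0.scomp (0 : ℝ) (hd 0)

/-- The tangent space `T_x M`: velocities at `x` of differentiable curves in `M` through `x`. -/
def tangentAt {d : ℕ} (M : Set (Fin d → ℝ)) (x : Fin d → ℝ) : Set (Fin d → ℝ) :=
  {v | ∃ ε : ℝ, 0 < ε ∧ ∃ f : ℝ → (Fin d → ℝ),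
    (∀ t ∈ Set.Ioo (-ε) ε, f t ∈ M ∧ DifferentiableAt ℝ f t) ∧ f 0 = x ∧ HasDerivAt f v 0}

/-- `S_x M = {A ∈ ℝ^{d×d} : A x ∈ T_x M}`. -/
def tangentStab {d : ℕ} (M : Set (Fin d → ℝ)) (x : Fin d → ℝ) :
    Set (Matrix (Fin d) (Fin d) ℝ) :=
  {A | A.mulVec x ∈ tangentAt M x}

/-- `M` is a smooth embedded submanifold of `ℝ^d` of codimension `m`: near each of its points it is
the zero set of a smooth submersion to `ℝ^m`. -/
def IsSubmanifoldOfCodim {d : ℕ} (M : Set (Fin d → ℝ)) (m : ℕ) : Prop :=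
  ∀ x ∈ M, ∃ U : Set (Fin d → ℝ), IsOpen U ∧ x ∈ U ∧ ∃ F : (Fin d → ℝ) → (Fin m → ℝ),
    ContDiffOn ℝ ∞ F U ∧ (∀ y ∈ U, Function.Surjective (fderiv ℝ F y)) ∧
    M ∩ U = {y ∈ U | F y = 0}

/-- The codimension of a nonempty submanifold of `ℝ^d` (for which there is exactly one `m`). -/
noncomputable def submanifoldCodim {d : ℕ} (M : Set (Fin d → ℝ)) : ℕ :=
  sInf {m | IsSubmanifoldOfCodim M m}

/-- `n⋆(M) = codim 𝔰𝔶𝔪(M) / codim M`. -/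
noncomputable def nStar {d : ℕ} (M : Set (Fin d → ℝ)) : ℚ :=
  (Module.finrank ℝ (Matrix (Fin d) (Fin d) ℝ ⧸ symAlg M) : ℚ) / (submanifoldCodim M : ℚ)

/-- `n°(M)`: the infimum, `∞` if there is none, of the `n` such that all `(x_1, …, x_n)` in some
open and dense subset of `M^n` satisfy `𝔰𝔶𝔪(M) = ⋂ i, S_{x_i} M`. -/
noncomputable def nCirc {d : ℕ} (M : Set (Fin d → ℝ)) : ℕ∞ :=
  ⨅ n ∈ {n : ℕ | ∃ O : Set (Fin n → M), IsOpen O ∧ Dense O ∧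
    ∀ x ∈ O, (symAlg M : Set (Matrix (Fin d) (Fin d) ℝ)) =
      ⋂ i, tangentStab M (x i : Fin d → ℝ)}, (n : ℕ∞)

/-- The nonzero isotropic vectors of `Q`: all `x ≠ 0` with `xᵀ Q x = 0`. -/
def quadricCone {d : ℕ} (Q : Matrix (Fin d) (Fin d) ℝ) : Set (Fin d → ℝ) :=
  {x | x ≠ 0 ∧ x ⬝ᵥ Q.mulVec x = 0}

/-- `P` is invertible with inverse `R`, and `Q = Pᵀ diag(1_p, -1_q) P`; so `Q` has signature
`(p, q)`. -/
def IsSylvesterForm {d p q : ℕ} (Q : Matrix (Fin d) (Fin d) ℝ)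
    (P : Matrix (Fin p ⊕ Fin q) (Fin d) ℝ) (R : Matrix (Fin d) (Fin p ⊕ Fin q) ℝ) : Prop :=
  P * R = 1 ∧ R * P = 1 ∧
    Q = P.transpose * LieAlgebra.Orthogonal.indefiniteDiagonal (Fin p) (Fin q) ℝ * P

/-!
Write `⟨x, y⟩ = xᵀ Q y` and `q(x) = ⟨x, x⟩`, and let `M` be the cone of nonzero isotropic vectors.

Since `Q` is nondegenerate, every `x ∈ M` has a partner `y` with `q(y) = 0` and `⟨x, y⟩ = 1`
(`exists_hyperbolic_partner`). Moving from `x` in a direction `v` orthogonal to `x` and correcting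
along `y` gives explicit curves in `M`, so `T_x M` is the orthogonal complement of `x`
(`mem_tangentAt_quadricCone_iff`), and `A ∈ S_x M` means `⟨x, A x⟩ = 0`, that is, the quadratic form
of `QA + AᵀQ` vanishes at `x`.

A matrix in the Lie algebra lies in every `S_x M`. Hence the quadratic form of `QA + AᵀQ` vanishes
on `M`, and as `q` is indefinite, this makes it a multiple of `q`: restrict both forms to the lines
joining a positive to a negative vector
(`exists_apply_self_eq_mul_of_forall_isotropic`). So `A` is skew-adjoint up to a scalar matrix.
Conversely, the exponentials of such matrices scale `q` and preserve `M`. This determines the Lie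
algebra (`symAlg_quadricCone_eq`). Its codimension is `binom(d+1, 2) - 1`, because
`A ↦ QA + AᵀQ` maps onto the symmetric matrices and the scalar matrices add one dimension to its
kernel.

Each `S_x M` is the kernel of one linear functional, so at least `binom(d+1, 2) - 1` points are
needed to cut out the Lie algebra, and that many suffice when the functionals are linearly
independent, which is an open condition. For `d ≥ 3` it is also dense. Indeed, a quadratic form that
vanishes on a nonempty open part of `M` near `x` is a multiple of `q`: compare coefficients along
the curves `x + t w - t² q(w)/2 y` with `w` orthogonal to `x` and `y`, using that some such `w` is
anisotropic (`apply_self_eq_mul_of_eventually_isotropic`). So independent points can be chosen one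
after the other in prescribed open sets. For `d = 2` there is no such `w`: `M` is a pair of lines
without the origin, and tuples of points on one line form an open set but never cut out the Lie
algebra (`nCirc_quadricCone_two`).

The normal form of the Lie algebra follows from Sylvester's law of inertia by conjugation.
-/

open Filter Topology

/-! ### Bilinear forms vanishing on isotropic vectors -/

section Bilinear

variable {V : Type*} [AddCommGroup V] [Module ℝ V] {B S : LinearMap.BilinForm ℝ V}

/-- On the line through `u` in direction `v`, the two quadratic forms are quadratic polynomials
with two common real roots, hence proportional. -/
theorem apply_self_mul_eq_of_forall_isotropic (hB : ∀ x y, B x y = B y x)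
    (hS : ∀ x y, S x y = S y x) (h : ∀ x, x ≠ 0 → B x x = 0 → S x x = 0) {u v : V}
    (hu : 0 < B u u) (hv : B v v < 0) : S u u * B v v = S v v * B u u := by
  have key (t : ℝ) (ht : B u u + 2 * t * B u v + t ^ 2 * B v v = 0) :
      S u u + 2 * t * S u v + t ^ 2 * S v v = 0 := by
    have h1 : S (u + t • v) (u + t • v) = 0 := by
      refine h _ (fun h0 => ?_) ?_
      · have h2 : u = -t • v := by rw [neg_smul]; exact eq_neg_of_add_eq_zero_left h0
        rw [h2] at hu
        simp only [map_smul, LinearMap.smul_apply, smul_eq_mul] at hu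
        nlinarith [sq_nonneg t]
      · simp only [map_add, map_smul, LinearMap.add_apply, LinearMap.smul_apply, smul_eq_mul,
          hB v u]
        linear_combination ht
    simp only [map_add, map_smul, LinearMap.add_apply, LinearMap.smul_apply, smul_eq_mul,
      hS v u] at h1
    linear_combination h1
  have hD : 0 < (B u v) ^ 2 - B u u * B v v := by nlinarith [sq_nonneg (B u v)]
  set r := √((B u v) ^ 2 - B u u * B v v) with hr
  have hr0 : r ≠ 0 := (Real.sqrt_pos.2 hD).ne'
  have hr2 : r ^ 2 = (B u v) ^ 2 - B u u * B v v := Real.sq_sqrt hD.le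
  have hv0 := hv.ne
  have k1 := key ((-B u v + r) / B v v) (by field_simp; linear_combination hr2)
  have k2 := key ((-B u v - r) / B v v) (by field_simp; linear_combination hr2)
  field_simp at k1 k2
  -- subtracting and adding the equations at the two roots compares the coefficients
  have k3 : B v v * S u v = S v v * B u v := by
    have : r * (B v v * S u v - S v v * B u v) = 0 := by linear_combination (k1 - k2) / 4
    linarith [(mul_eq_zero.1 this).resolve_left hr0]
  have k4 : B v v * (S u u * B v v - S v v * B u u) = 0 := by
    linear_combination (k1 + k2) / 2 + 2 * B u v * k3 - S v v * hr2
  linarith [(mul_eq_zero.1 k4).resolve_left hv0]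

/-- A quadratic form vanishing on the isotropic vectors of an indefinite form is a multiple of
it. -/
theorem exists_apply_self_eq_mul_of_forall_isotropic (hB : ∀ x y, B x y = B y x)
    (hS : ∀ x y, S x y = S y x) (h : ∀ x, x ≠ 0 → B x x = 0 → S x x = 0) {u v : V}
    (hu : 0 < B u u) (hv : B v v < 0) : ∃ c : ℝ, ∀ x, S x x = c * B x x := by
  have key {u v : V} (hu : 0 < B u u) (hv : B v v < 0) :=
    apply_self_mul_eq_of_forall_isotropic hB hS h hu hv
  have hu0 := hu.ne'
  have hv0 := hv.ne
  refine ⟨S u u / B u u, fun x => ?_⟩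
  rcases lt_trichotomy (B x x) 0 with hx | hx | hx
  · field_simp
    linear_combination -key hu hx
  · rw [hx, mul_zero]
    by_cases h0 : x = 0
    · simp [h0]
    · exact h x h0 hx
  · have h1 : S x x * B u u * B v v = S u u * B x x * B v v := by
      linear_combination B u u * key hx hv - B x x * key hu hv
    field_simp
    linear_combination mul_right_cancel₀ hv0 h1

theorem coeff_eq_zero_of_eventually_quartic_eq_zero {a b c d e : ℝ}
    (h : ∀ᶠ t : ℝ in 𝓝 0, a + b * t + c * t ^ 2 + d * t ^ 3 + e * t ^ 4 = 0) :
    a = 0 ∧ b = 0 ∧ c = 0 ∧ d = 0 ∧ e = 0 := by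
  open Polynomial in
  have hp : C a + C b * X + C c * X ^ 2 + C d * X ^ 3 + C e * X ^ 4 = (0 : ℝ[X]) := by
    refine Polynomial.eq_zero_of_infinite_isRoot _ ((infinite_of_mem_nhds 0 h).mono ?_)
    intro t ht
    simpa [Polynomial.IsRoot] using ht
  have hc (n : ℕ) := congrArg (fun p => Polynomial.coeff p n) hp
  refine ⟨?_, ?_, ?_, ?_, ?_⟩
  · simpa [Polynomial.coeff_X, Polynomial.coeff_C] using hc 0
  · simpa [Polynomial.coeff_X, Polynomial.coeff_C] using hc 1
  · simpa [Polynomial.coeff_X, Polynomial.coeff_C] using hc 2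
  · simpa [Polynomial.coeff_X, Polynomial.coeff_C] using hc 3
  · simpa [Polynomial.coeff_X, Polynomial.coeff_C] using hc 4

/-- For a hyperbolic pair `x, y` and `w` orthogonal to both, the curve
`t ↦ x + t w - t² q(w)/2 y` consists of isotropic vectors. If a quadratic form vanishes on these
curves near `t = 0`, comparing coefficients of powers of `t` identifies it, provided that there is
an anisotropic `w`. -/
theorem apply_self_eq_mul_of_eventually_isotropic (hB : ∀ x y, B x y = B y x)
    (hS : ∀ x y, S x y = S y x) {x y : V} (hx : B x x = 0) (hy : B y y = 0) (hxy : B x y = 1)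
    (hw : ∃ w, B x w = 0 ∧ B y w = 0 ∧ B w w ≠ 0)
    (h : ∀ w, B x w = 0 → B y w = 0 → ∀ᶠ t : ℝ in 𝓝 0,
      S (x + t • w - (t ^ 2 * B w w / 2) • y) (x + t • w - (t ^ 2 * B w w / 2) • y) = 0) (z : V) :
    S z z = S x y * B z z := by
  have key (w : V) (h1 : B x w = 0) (h2 : B y w = 0) : S x x = 0 ∧ S x w = 0 ∧
      S w w = B w w * S x y ∧ B w w * S w y = 0 ∧ B w w ^ 2 * S y y = 0 := by
    obtain ⟨e0, e1, e2, e3, e4⟩ := coeff_eq_zero_of_eventually_quartic_eq_zero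
      (a := S x x) (b := 2 * S x w) (c := S w w - B w w * S x y) (d := - (B w w * S w y))
      (e := B w w ^ 2 * S y y / 4) (by
        filter_upwards [h w h1 h2] with t ht
        simp only [map_add, map_sub, map_smul, LinearMap.add_apply, LinearMap.sub_apply,
          LinearMap.smul_apply, smul_eq_mul, hS w x, hS y x, hS y w] at ht
        linear_combination ht)
    exact ⟨e0, by linarith, by linarith, by linarith, by linarith⟩
  obtain ⟨w₀, hw1, hw2, hw0⟩ := hw
  obtain ⟨k1, k2, k3, k4, k5⟩ := key w₀ hw1 hw2
  have hSy : S y y = 0 := (mul_eq_zero.1 k5).resolve_left (pow_ne_zero _ hw0)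
  have hSw₀ : S w₀ y = 0 := (mul_eq_zero.1 k4).resolve_left hw0
  have hSw (w : V) (h1 : B x w = 0) (h2 : B y w = 0) : S w y = 0 := by
    -- one of `w`, `w + w₀`, `w - w₀` is anisotropic
    obtain ⟨-, -, -, l0, -⟩ := key w h1 h2
    obtain ⟨-, -, -, l1, -⟩ := key (w + w₀) (by simp [h1, hw1]) (by simp [h2, hw2])
    obtain ⟨-, -, -, l2, -⟩ := key (w - w₀) (by simp [h1, hw1]) (by simp [h2, hw2])
    simp only [map_add, map_sub, LinearMap.add_apply, LinearMap.sub_apply, hSw₀, hB w₀ w,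
      add_zero, sub_zero] at l1 l2
    have : B w₀ w₀ * S w y = 0 := by linear_combination (l1 + l2) / 2 - l0
    exact (mul_eq_zero.1 this).resolve_left hw0
  obtain ⟨w, hz, h1, h2⟩ : ∃ w, z = B z y • x + B z x • y + w ∧ B x w = 0 ∧ B y w = 0 := by
    refine ⟨z - B z y • x - B z x • y, by abel, ?_, ?_⟩
    · simp [hx, hxy, hB z x]
    · simp [hy, hB y x, hxy, hB z y]
  obtain ⟨-, l1, l2, -, -⟩ := key w h1 h2
  have l3 := hSw w h1 h2
  rw [hz]
  generalize B z y = α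
  generalize B z x = β
  simp only [map_add, map_smul, LinearMap.add_apply, LinearMap.smul_apply, smul_eq_mul, hx, hy,
    hxy, hB y x, hS y x, hB w x, hB w y, hS w x, hS y w, k1, hSy, h1, h2, l1, l2, l3]
  ring

end Bilinear

/-! ### Tangent spaces of the cone -/

section Cone

open Matrix

variable {d : ℕ} {Q : Matrix (Fin d) (Fin d) ℝ}

theorem toBilin'_comm (hQ : Q.IsSymm) (x y : Fin d → ℝ) : toBilin' Q x y = toBilin' Q y x := by
  rw [toBilin'_apply', toBilin'_apply', dotProduct_mulVec, dotProduct_comm, ← mulVec_transpose,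
    hQ.eq]

theorem mem_quadricCone_iff {x : Fin d → ℝ} :
    x ∈ quadricCone Q ↔ x ≠ 0 ∧ toBilin' Q x x = 0 := by
  simp [quadricCone, toBilin'_apply']

theorem exists_toBilin'_ne_zero (hQ : Q.IsSymm) (hu : IsUnit Q) {x : Fin d → ℝ} (hx : x ≠ 0) :
    ∃ z, toBilin' Q x z ≠ 0 := by
  by_contra! h
  refine hx (mulVec_injective_of_isUnit hu ?_)
  rw [mulVec_zero]
  refine dotProduct_eq_zero _ fun z => ?_
  rw [dotProduct_comm, ← toBilin'_apply', toBilin'_comm hQ, h]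

/-- Every nonzero isotropic vector belongs to a hyperbolic pair. -/
theorem exists_hyperbolic_partner (hQ : Q.IsSymm) (hu : IsUnit Q) {x : Fin d → ℝ}
    (hx : x ∈ quadricCone Q) : ∃ y, toBilin' Q y y = 0 ∧ toBilin' Q x y = 1 := by
  rw [mem_quadricCone_iff] at hx
  obtain ⟨z, hz⟩ := exists_toBilin'_ne_zero hQ hu hx.1
  set a := toBilin' Q x z with ha
  refine ⟨a⁻¹ • z - (a⁻¹ ^ 2 * toBilin' Q z z / 2) • x, ?_, ?_⟩
  · simp only [map_sub, map_smul, LinearMap.sub_apply, LinearMap.smul_apply, smul_eq_mul, hx.2,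
      toBilin'_comm hQ z x, ← ha]
    field_simp
    ring
  · simp only [map_sub, map_smul, smul_eq_mul, hx.2, ← ha]
    field_simp
    ring

theorem HasDerivAt.toBilin'_self (hQ : Q.IsSymm) {f : ℝ → Fin d → ℝ} {v : Fin d → ℝ} {t : ℝ}
    (hf : HasDerivAt f v t) :
    HasDerivAt (fun s => toBilin' Q (f s) (f s)) (2 * toBilin' Q (f t) v) t := by
  have h2 : HasDerivAt (fun s => f s ⬝ᵥ Q *ᵥ f s) (∑ i, (v i * (Q *ᵥ f t) i +
      f t i * (Q *ᵥ v) i)) t := by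
    simp only [dotProduct]
    refine HasDerivAt.fun_sum fun i _ => ((hasDerivAt_pi.1 hf i).mul ?_)
    simp only [mulVec, dotProduct]
    exact HasDerivAt.fun_sum fun j _ => (hasDerivAt_pi.1 hf j).const_mul _
  simp only [toBilin'_apply'] at *
  convert h2 using 1
  rw [Finset.sum_add_distrib]
  change _ = v ⬝ᵥ Q *ᵥ f t + f t ⬝ᵥ Q *ᵥ v
  rw [← toBilin'_apply', ← toBilin'_apply', toBilin'_comm hQ v]
  ring

theorem toBilin'_eq_zero_of_mem_tangentAt (hQ : Q.IsSymm) {x v : Fin d → ℝ}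
    (hv : v ∈ tangentAt (quadricCone Q) x) : toBilin' Q x v = 0 := by
  obtain ⟨ε, hε, f, hf, rfl, hfv⟩ := hv
  have h1 := hfv.toBilin'_self hQ
  have h2 : HasDerivAt (fun s => toBilin' Q (f s) (f s)) 0 0 := by
    refine (hasDerivAt_const (0 : ℝ) (0 : ℝ)).congr_of_eventuallyEq ?_
    filter_upwards [Ioo_mem_nhds (neg_lt_zero.2 hε) hε] with t ht
    exact (mem_quadricCone_iff.1 (hf t ht).1).2
  linarith [h1.unique h2]

/-- For a hyperbolic pair `x, y` and `v` orthogonal to `x`, the curve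
`t ↦ x + t v - t² q(v) / (2 (1 + t ⟨v, y⟩)) y` stays in the cone and has velocity `v`. -/
theorem mem_tangentAt_quadricCone_iff (hQ : Q.IsSymm) (hu : IsUnit Q) {x v : Fin d → ℝ}
    (hx : x ∈ quadricCone Q) : v ∈ tangentAt (quadricCone Q) x ↔ toBilin' Q x v = 0 := by
  refine ⟨toBilin'_eq_zero_of_mem_tangentAt hQ, fun hv => ?_⟩
  obtain ⟨y, hy, hxy⟩ := exists_hyperbolic_partner hQ hu hx
  have hxx := (mem_quadricCone_iff.1 hx).2
  set a := toBilin' Q v y with ha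
  -- this interval keeps the denominator `1 + t ⟨v, y⟩` positive
  have hpos {t : ℝ} (ht : t ∈ Set.Ioo (-(1 / (|a| + 1))) (1 / (|a| + 1))) : 0 < 1 + t * a := by
    have h1 : |t| < 1 / (|a| + 1) := abs_lt.2 ht
    rw [lt_div_iff₀ (by positivity)] at h1
    have h2 : |t * a| < 1 := by rw [abs_mul]; nlinarith [abs_nonneg t]
    linarith [(abs_lt.1 h2).1]
  have hder {t : ℝ} (ht : 1 + t * a ≠ 0) : HasDerivAt
      (fun s : ℝ => x + s • v - (s ^ 2 * toBilin' Q v v / (2 * (1 + s * a))) • y)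
      (v - (t * toBilin' Q v v * (2 + t * a) / (2 * (1 + t * a) ^ 2)) • y) t := by
    have hd : HasDerivAt (fun s : ℝ => 2 * (1 + s * a)) (2 * a) t := by
      simpa using (((hasDerivAt_id t).mul_const a).const_add 1).const_mul 2
    have hn : HasDerivAt (fun s : ℝ => s ^ 2 * toBilin' Q v v) (2 * t * toBilin' Q v v) t := by
      simpa using (hasDerivAt_pow 2 t).mul_const (toBilin' Q v v)
    have h1 : HasDerivAt (fun s : ℝ => x + s • v) v t := by
      simpa using ((hasDerivAt_id t).smul_const v).const_add x
    have hq := hn.div hd (by positivity)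
    refine (h1.sub (hq.smul_const y)).congr_deriv ?_
    congr 2
    field_simp
    ring
  refine ⟨1 / (|a| + 1), by positivity, _, fun t ht => ⟨?_, (hder (hpos ht).ne').differentiableAt⟩,
    by simp, by simpa using hder (t := 0) (by simp)⟩
  have h0 := (hpos ht).ne'
  rw [mem_quadricCone_iff]
  constructor
  · intro h
    have h1 : toBilin' Q (x + t • v - (t ^ 2 * toBilin' Q v v / (2 * (1 + t * a))) • y) y = 0 := by
      rw [h]; simp
    refine h0 ?_
    simpa [hxy, hy, ← ha] using h1
  · simp only [map_add, map_sub, map_smul, LinearMap.add_apply, LinearMap.sub_apply,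
      LinearMap.smul_apply, smul_eq_mul, toBilin'_comm hQ v x, toBilin'_comm hQ y x,
      toBilin'_comm hQ y v, hxx, hxy, hy, hv, ← ha]
    field_simp
    ring

theorem mem_tangentStab_quadricCone_iff (hQ : Q.IsSymm) (hu : IsUnit Q) {x : Fin d → ℝ}
    (hx : x ∈ quadricCone Q) {A : Matrix (Fin d) (Fin d) ℝ} :
    A ∈ tangentStab (quadricCone Q) x ↔ toBilin' Q x (A *ᵥ x) = 0 :=
  mem_tangentAt_quadricCone_iff hQ hu hx

/-! ### The Lie algebra of the symmetry group -/

theorem mem_tangentStab_of_mem_symAlg {M : Set (Fin d → ℝ)} {A : Matrix (Fin d) (Fin d) ℝ}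
    (hA : A ∈ symAlg M) {x : Fin d → ℝ} (hx : x ∈ M) : A ∈ tangentStab M x := by
  obtain ⟨ε, hε, f, hf, hf0, hfA⟩ := hA
  have hder {t : ℝ} {F : Matrix (Fin d) (Fin d) ℝ} (h : HasDerivAt f F t) :
      HasDerivAt (fun s => f s *ᵥ x) (F *ᵥ x) t := by
    refine hasDerivAt_pi.2 fun i => ?_
    simp only [mulVec, dotProduct]
    exact HasDerivAt.fun_sum fun j _ => (hasDerivAt_pi.1 (hasDerivAt_pi.1 h i) j).mul_const _
  refine ⟨ε, hε, fun t => f t *ᵥ x, fun t ht => ⟨?_, ?_⟩, by simp [hf0], hder hfA⟩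
  · obtain ⟨⟨A, hA, hAf⟩, -⟩ := hf t ht
    beta_reduce
    rw [← hAf]
    have hA' : (fun x => (A : Matrix (Fin d) (Fin d) ℝ) *ᵥ x) '' M = M := hA
    exact hA'.subset ⟨x, hx, rfl⟩
  · let _ := Matrix.linftyOpNormedRing (n := Fin d) (α := ℝ)
    let _ := Matrix.linftyOpNormedAlgebra (R := ℝ) (n := Fin d) (α := ℝ)
    have h1 : HasDerivAt f (deriv f t) t := (hf t ht).2.hasDerivAt
    exact (hder h1).differentiableAt

/-- A matrix that scales the quadratic form by a nonzero factor preserves the cone. -/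
theorem mem_symGroup_quadricCone {A : GL (Fin d) ℝ} {c : ℝ} (hc : c ≠ 0)
    (h : (A : Matrix (Fin d) (Fin d) ℝ)ᵀ * Q * (A : Matrix (Fin d) (Fin d) ℝ) = c • Q) :
    A ∈ symGroup (quadricCone Q) := by
  have key (x : Fin d → ℝ) : (A : Matrix (Fin d) (Fin d) ℝ) *ᵥ x ∈ quadricCone Q ↔
      x ∈ quadricCone Q := by
    have h1 : toBilin' Q ((A : Matrix (Fin d) (Fin d) ℝ) *ᵥ x)
        ((A : Matrix (Fin d) (Fin d) ℝ) *ᵥ x) = c * toBilin' Q x x := by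
      rw [← smul_eq_mul, ← LinearMap.smul_apply, ← LinearMap.smul_apply, ← map_smul, ← h]
      simp only [toBilin'_apply', ← mulVec_mulVec]
      rw [dotProduct_mulVec x, vecMul_transpose]
    have h2 : (A : Matrix (Fin d) (Fin d) ℝ) *ᵥ x = 0 ↔ x = 0 := by
      refine ⟨fun h0 => mulVec_injective_of_isUnit A.isUnit (by rw [h0, mulVec_zero]), ?_⟩
      rintro rfl
      exact mulVec_zero _
    rw [mem_quadricCone_iff, mem_quadricCone_iff, h1, mul_eq_zero, or_iff_right hc, Ne, h2]
  change (fun x => (A : Matrix (Fin d) (Fin d) ℝ) *ᵥ x) '' quadricCone Q = quadricCone Q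
  refine Set.Subset.antisymm (by rintro _ ⟨x, hx, rfl⟩; exact (key x).2 hx) fun x hx => ?_
  have hx' : (A : Matrix (Fin d) (Fin d) ℝ) *ᵥ
      ((A⁻¹ : GL (Fin d) ℝ) : Matrix (Fin d) (Fin d) ℝ) *ᵥ x = x := by
    rw [mulVec_mulVec, ← Units.val_mul, mul_inv_cancel, Units.val_one, one_mulVec]
  exact ⟨_, (key _).1 (by rwa [hx']), hx'⟩

/-- If the one-parameter group of `Z` scales the quadratic form, then `Z` is in the Lie algebra. -/
theorem mem_symAlg_of_exp {Z : Matrix (Fin d) (Fin d) ℝ}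
    (h : ∀ t : ℝ, ∃ c : ℝ, c ≠ 0 ∧ (NormedSpace.exp (t • Z))ᵀ * Q * NormedSpace.exp (t • Z) = c • Q) :
    Z ∈ symAlg (quadricCone Q) := by
  let _ := Matrix.linftyOpNormedRing (n := Fin d) (α := ℝ)
  let _ := Matrix.linftyOpNormedAlgebra (R := ℝ) (n := Fin d) (α := ℝ)
  refine ⟨1, one_pos, fun t => NormedSpace.exp (t • Z), fun t _ => ⟨?_, ?_⟩, by simp, ?_⟩
  · obtain ⟨c, hc, hcZ⟩ := h t
    exact ⟨(Matrix.isUnit_exp (t • Z)).unit, mem_symGroup_quadricCone hc hcZ, rfl⟩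
  · have h1 : HasDerivAt (fun s : ℝ => NormedSpace.exp (s • Z)) _ t := hasDerivAt_exp_smul_const Z t
    exact h1.differentiableAt
  · have h1 : HasDerivAt (fun s : ℝ => NormedSpace.exp (s • Z)) _ 0 :=
      hasDerivAt_exp_smul_const Z (0 : ℝ)
    simpa using h1

theorem mem_skewAdjoint_iff {Z : Matrix (Fin d) (Fin d) ℝ} :
    Z ∈ skewAdjointMatricesSubmodule Q ↔ Zᵀ * Q = -(Q * Z) := by
  rw [mem_skewAdjointMatricesSubmodule, Matrix.IsSkewAdjoint, Matrix.IsAdjointPair, mul_neg]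

theorem skewAdjoint_le_symAlg (hu : IsUnit Q) :
    skewAdjointMatricesSubmodule Q ≤ symAlg (quadricCone Q) := by
  intro Z hZ
  rw [mem_skewAdjoint_iff] at hZ
  refine mem_symAlg_of_exp fun t => ⟨1, one_ne_zero, ?_⟩
  have hdet : IsUnit Q.det := (isUnit_iff_isUnit_det Q).1 hu
  have h1 : (t • Z)ᵀ = Q * (-(t • Z)) * Q⁻¹ := by
    have h3 : Zᵀ = -(Q * Z * Q⁻¹) := by
      rw [← neg_mul, ← hZ, mul_assoc, mul_nonsing_inv _ hdet, mul_one]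
    rw [transpose_smul, h3, mul_neg, neg_mul, smul_neg, mul_smul_comm, smul_mul_assoc]
  have h2 : (NormedSpace.exp (t • Z))ᵀ = Q * (NormedSpace.exp (t • Z))⁻¹ * Q⁻¹ := by
    rw [← exp_neg, ← exp_conj _ _ hu, ← h1, exp_transpose]
  have h4 : IsUnit (NormedSpace.exp (t • Z)).det :=
    (isUnit_iff_isUnit_det _).1 (isUnit_exp (t • Z))
  rw [h2, one_smul, mul_assoc (Q * _), nonsing_inv_mul _ hdet, mul_one, mul_assoc,
    nonsing_inv_mul _ h4, mul_one]

theorem one_mem_symAlg_quadricCone : 1 ∈ symAlg (quadricCone Q) := by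
  refine mem_symAlg_of_exp fun t => ⟨Real.exp t * Real.exp t, by positivity, ?_⟩
  have : NormedSpace.exp (t • (1 : Matrix (Fin d) (Fin d) ℝ)) = Real.exp t • 1 := by
    rw [smul_one_eq_diagonal, smul_one_eq_diagonal, exp_diagonal]
    congr 1
    ext i
    rw [Pi.coe_exp, Real.exp_eq_exp_ℝ]
  rw [this]
  simp [smul_smul]

theorem toBilin'_mul_add_transpose_mul (hQ : Q.IsSymm) (A : Matrix (Fin d) (Fin d) ℝ)
    (x : Fin d → ℝ) : toBilin' (Q * A + Aᵀ * Q) x x = 2 * toBilin' Q x (A *ᵥ x) := by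
  have h : toBilin' (Aᵀ * Q) x x = toBilin' Q x (A *ᵥ x) := by
    rw [toBilin'_comm hQ]
    simp only [toBilin'_apply', ← mulVec_mulVec]
    rw [dotProduct_mulVec, vecMul_transpose]
  rw [map_add, LinearMap.add_apply, LinearMap.add_apply, h, toBilin'_apply', ← mulVec_mulVec,
    ← toBilin'_apply']
  ring

theorem isSymm_mul_add_transpose_mul (hQ : Q.IsSymm) (A : Matrix (Fin d) (Fin d) ℝ) :
    (Q * A + Aᵀ * Q).IsSymm := by
  rw [Matrix.IsSymm, transpose_add, transpose_mul, transpose_mul, transpose_transpose, hQ.eq,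
    add_comm]

theorem Matrix.IsSymm.eq_of_toBilin'_self {A C : Matrix (Fin d) (Fin d) ℝ} (hA : A.IsSymm)
    (hC : C.IsSymm) (h : ∀ x, toBilin' A x x = toBilin' C x x) : A = C := by
  apply toBilin'.injective
  refine LinearMap.ext₂ fun x y => ?_
  have h1 := h (x + y)
  simp only [map_add (toBilin' A), map_add (toBilin' C), map_add (toBilin' A _),
    map_add (toBilin' C _), LinearMap.add_apply, h x, h y, toBilin'_comm hA y x,
    toBilin'_comm hC y x] at h1
  linarith

/-- If `QA + AᵀQ` is a multiple of `Q` as a quadratic form, then `A` is skew-adjoint up to a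
scalar matrix. -/
theorem mem_skewAdjoint_sup_of_apply_self_eq (hQ : Q.IsSymm) {A : Matrix (Fin d) (Fin d) ℝ} {c : ℝ}
    (h : ∀ x, toBilin' (Q * A + Aᵀ * Q) x x = c * toBilin' Q x x) :
    A ∈ skewAdjointMatricesSubmodule Q ⊔ Submodule.span ℝ {1} := by
  have hQA : Q * A + Aᵀ * Q = c • Q := by
    refine (isSymm_mul_add_transpose_mul hQ A).eq_of_toBilin'_self (hQ.smul c) fun x => ?_
    rw [h, map_smul, LinearMap.smul_apply, LinearMap.smul_apply, smul_eq_mul]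
  rw [Submodule.mem_sup]
  refine ⟨A - (c / 2) • 1, ?_, (c / 2) • 1,
    Submodule.smul_mem _ _ (Submodule.mem_span_singleton_self _), by simp⟩
  rw [mem_skewAdjoint_iff]
  have h2 : Aᵀ * Q = c • Q - Q * A := by rw [← hQA]; abel
  simp only [transpose_sub, transpose_smul, transpose_one, sub_mul, mul_sub, h2, smul_mul_assoc,
    one_mul, mul_smul_comm, mul_one]
  module

theorem symAlg_quadricCone_eq (hQ : Q.IsSymm) (hu : IsUnit Q) {u v : Fin d → ℝ}
    (hup : 0 < toBilin' Q u u) (hvn : toBilin' Q v v < 0) :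
    symAlg (quadricCone Q) = skewAdjointMatricesSubmodule Q ⊔ Submodule.span ℝ {1} := by
  apply le_antisymm
  · intro A hA
    obtain ⟨c, hc⟩ := exists_apply_self_eq_mul_of_forall_isotropic (toBilin'_comm hQ)
      (toBilin'_comm (isSymm_mul_add_transpose_mul hQ A)) (fun x hx hxx => by
        have hx' : x ∈ quadricCone Q := mem_quadricCone_iff.2 ⟨hx, hxx⟩
        rw [toBilin'_mul_add_transpose_mul hQ, (mem_tangentStab_quadricCone_iff hQ hu hx').1
          (mem_tangentStab_of_mem_symAlg hA hx'), mul_zero]) hup hvn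
    exact mem_skewAdjoint_sup_of_apply_self_eq hQ hc
  · rw [sup_le_iff, Submodule.span_singleton_le_iff_mem]
    exact ⟨skewAdjoint_le_symAlg hu, one_mem_symAlg_quadricCone⟩

end Cone

/-! ### Signs of the quadratic form -/

section Signs

open Matrix

variable {d : ℕ} {Q : Matrix (Fin d) (Fin d) ℝ}

theorem isUnit_of_rank_eq (h : Q.rank = d) : IsUnit Q := by
  rw [← mulVec_surjective_iff_isUnit]
  have h1 : LinearMap.range Q.mulVecLin = ⊤ := by
    apply Submodule.eq_top_of_finrank_eq
    simpa [Matrix.rank] using h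
  exact LinearMap.range_eq_top.1 h1

theorem exists_toBilin'_neg_of_not_posDef (hQ : Q.IsSymm) (hu : IsUnit Q) (h : ¬ Q.PosDef) :
    ∃ v, toBilin' Q v v < 0 := by
  by_contra! h1
  have h2 : Q.PosSemidef := .of_dotProduct_mulVec_nonneg (by simpa using hQ) fun x => by
    simpa [toBilin'_apply'] using h1 x
  exact h (h2.posDef_iff_isUnit.2 hu)

theorem exists_toBilin'_pos_of_not_posDef_neg (hQ : Q.IsSymm) (hu : IsUnit Q)
    (h : ¬ (-Q).PosDef) : ∃ v, 0 < toBilin' Q v v := by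
  obtain ⟨v, hv⟩ := exists_toBilin'_neg_of_not_posDef hQ.neg hu.neg h
  exact ⟨v, by simpa using hv⟩

/-- On the line through `u` and `v`, the quadratic form has a zero. -/
theorem quadricCone_nonempty (hQ : Q.IsSymm) {u v : Fin d → ℝ} (hu : 0 < toBilin' Q u u)
    (hv : toBilin' Q v v < 0) : (quadricCone Q).Nonempty := by
  have hD : 0 < (toBilin' Q u v) ^ 2 - toBilin' Q u u * toBilin' Q v v := by
    nlinarith [sq_nonneg (toBilin' Q u v)]
  set r := √((toBilin' Q u v) ^ 2 - toBilin' Q u u * toBilin' Q v v) with hr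
  have hr2 : r ^ 2 = (toBilin' Q u v) ^ 2 - toBilin' Q u u * toBilin' Q v v := Real.sq_sqrt hD.le
  have hv0 := hv.ne
  refine ⟨u + ((-toBilin' Q u v + r) / toBilin' Q v v) • v, ?_⟩
  generalize ht : (-toBilin' Q u v + r) / toBilin' Q v v = t
  rw [mem_quadricCone_iff]
  constructor
  · intro h0
    have h2 : u = -t • v := by rw [neg_smul]; exact eq_neg_of_add_eq_zero_left h0
    rw [h2] at hu
    simp only [map_smul, LinearMap.smul_apply, smul_eq_mul] at hu
    nlinarith [sq_nonneg t]
  · simp only [map_add, map_smul, LinearMap.add_apply, LinearMap.smul_apply, smul_eq_mul,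
      toBilin'_comm hQ v u, ← ht]
    field_simp
    linear_combination hr2

theorem quadricCone_eq_empty_iff (hQ : Q.IsSymm) (hu : IsUnit Q) :
    quadricCone Q = ∅ ↔ Q.PosDef ∨ (-Q).PosDef := by
  constructor
  · contrapose!
    rintro ⟨h1, h2⟩
    obtain ⟨v, hv⟩ := exists_toBilin'_neg_of_not_posDef hQ hu h1
    obtain ⟨u, hu⟩ := exists_toBilin'_pos_of_not_posDef_neg hQ hu h2
    exact quadricCone_nonempty hQ hu hv
  · rintro h
    refine Set.eq_empty_of_forall_notMem fun x ⟨hx, hxx⟩ => ?_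
    rcases h with h | h
    · simpa [hxx] using h.dotProduct_mulVec_pos hx
    · simpa [hxx, neg_mulVec] using h.dotProduct_mulVec_pos hx

/-! ### The cone as a submanifold -/

theorem isSubmanifoldOfCodim_one_quadricCone (hQ : Q.IsSymm) (hu : IsUnit Q) :
    IsSubmanifoldOfCodim (quadricCone Q) 1 := by
  intro x hx
  have hsm : ContDiff ℝ ∞ fun (y : Fin d → ℝ) (_ : Fin 1) => toBilin' Q y y := by
    simp only [toBilin'_apply', dotProduct, mulVec]
    fun_prop
  refine ⟨{0}ᶜ, isOpen_compl_singleton, hx.1, _, hsm.contDiffOn, fun y hy w => ?_, ?_⟩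
  · obtain ⟨z, hz⟩ := exists_toBilin'_ne_zero hQ hu hy
    refine ⟨(w 0 / (2 * toBilin' Q y z)) • z, ?_⟩
    have hd : HasFDerivAt (fun (y : Fin d → ℝ) (_ : Fin 1) => toBilin' Q y y) _ y :=
      (hsm.differentiable (by simp) y).hasFDerivAt
    have hl : HasDerivAt (fun t : ℝ => y + t • z) z 0 := by
      simpa using ((hasDerivAt_id (0 : ℝ)).smul_const z).const_add y
    have h1 := HasFDerivAt.comp_hasDerivAt_of_eq (0 : ℝ) hd hl (by simp)
    have h2 : HasDerivAt (fun (t : ℝ) (_ : Fin 1) => toBilin' Q (y + t • z) (y + t • z))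
        (fun _ => 2 * toBilin' Q y z) 0 :=
      hasDerivAt_pi.2 fun _ => by simpa using hl.toBilin'_self hQ
    have h3 := h1.unique h2
    rw [map_smul, h3]
    ext i
    rw [Subsingleton.elim i 0]
    simp only [Pi.smul_apply, smul_eq_mul]
    field_simp
  · ext y
    simp [mem_quadricCone_iff, funext_iff, and_comm]

theorem not_isSubmanifoldOfCodim_zero_quadricCone (hQ : Q.IsSymm) (hu : IsUnit Q)
    (hne : (quadricCone Q).Nonempty) : ¬ IsSubmanifoldOfCodim (quadricCone Q) 0 := by
  intro h
  obtain ⟨x, hx⟩ := hne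
  obtain ⟨U, hU, hxU, F, -, -, hF⟩ := h x hx
  obtain ⟨y, hy, hxy⟩ := exists_hyperbolic_partner hQ hu hx
  have hc : Tendsto (fun t : ℝ => x + t • y) (𝓝 0) (𝓝 x) := by
    have : ContinuousAt (fun t : ℝ => x + t • y) 0 := by fun_prop
    simpa [ContinuousAt] using this
  have h1 : ∀ᶠ t : ℝ in 𝓝[≠] 0, x + t • y ∈ U :=
    (hc.eventually (hU.mem_nhds hxU)).filter_mono nhdsWithin_le_nhds
  obtain ⟨t, htU, ht⟩ := (h1.and self_mem_nhdsWithin).exists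
  have h2 : x + t • y ∈ quadricCone Q ∩ U := by
    rw [hF]
    exact ⟨htU, Subsingleton.elim _ _⟩
  have h3 := (mem_quadricCone_iff.1 h2.1).2
  simp only [map_add, map_smul, LinearMap.add_apply, LinearMap.smul_apply, smul_eq_mul,
    toBilin'_comm hQ y x, (mem_quadricCone_iff.1 hx).2, hxy, hy] at h3
  exact ht (by simpa using h3 : t = 0)

theorem submanifoldCodim_quadricCone (hQ : Q.IsSymm) (hu : IsUnit Q)
    (hne : (quadricCone Q).Nonempty) : submanifoldCodim (quadricCone Q) = 1 := by
  have h1 : 1 ∈ {m | IsSubmanifoldOfCodim (quadricCone Q) m} :=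
    isSubmanifoldOfCodim_one_quadricCone hQ hu
  refine le_antisymm (Nat.sInf_le h1) (Nat.one_le_iff_ne_zero.2 fun h0 => ?_)
  have h2 := Nat.sInf_mem ⟨1, h1⟩
  rw [submanifoldCodim] at h0
  rw [h0] at h2
  exact not_isSubmanifoldOfCodim_zero_quadricCone hQ hu hne h2

/-! ### The dimension of the Lie algebra -/

/-- The map `A ↦ QA + AᵀQ` onto symmetric matrices, encoded as functions on unordered pairs of
indices. -/
def symmetrizedMul (hQ : Q.IsSymm) :
    Matrix (Fin d) (Fin d) ℝ →ₗ[ℝ] (Sym2 (Fin d) → ℝ) where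
  toFun A := Sym2.lift ⟨fun i j => (Q * A + Aᵀ * Q) i j, fun i j =>
    ((isSymm_mul_add_transpose_mul hQ A).apply i j).symm⟩
  map_add' A C := by
    ext s
    induction s with | _ i j => ?_
    simp [mul_add, add_mul]
    ring
  map_smul' c A := by
    ext s
    induction s with | _ i j => ?_
    simp [mul_add]

theorem ker_symmetrizedMul (hQ : Q.IsSymm) :
    LinearMap.ker (symmetrizedMul hQ) = skewAdjointMatricesSubmodule Q := by
  ext A
  rw [LinearMap.mem_ker, mem_skewAdjoint_iff, eq_neg_iff_add_eq_zero, add_comm]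
  constructor
  · intro h
    ext i j
    exact congrFun h s(i, j)
  · intro h
    ext s
    induction s with | _ i j => ?_
    exact congrFun (congrFun h i) j

theorem symmetrizedMul_surjective (hQ : Q.IsSymm) (hu : IsUnit Q) :
    Function.Surjective (symmetrizedMul hQ) := by
  intro g
  have hdet : IsUnit Q.det := (isUnit_iff_isUnit_det Q).1 hu
  set G : Matrix (Fin d) (Fin d) ℝ := Matrix.of fun i j => g s(i, j) / 2
  have hG : Gᵀ = G := by
    ext i j
    simp [G, Sym2.eq_swap]
  refine ⟨Q⁻¹ * G, ?_⟩
  have h : Q * (Q⁻¹ * G) + (Q⁻¹ * G)ᵀ * Q = G + G := by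
    rw [← mul_assoc, mul_nonsing_inv _ hdet, one_mul, transpose_mul, transpose_nonsing_inv, hQ.eq,
      hG, mul_assoc, nonsing_inv_mul _ hdet, mul_one]
  ext s
  induction s with | _ i j => ?_
  change (Q * (Q⁻¹ * G) + (Q⁻¹ * G)ᵀ * Q) i j = _
  rw [h]
  simp [G]

theorem finrank_skewAdjoint_add (hQ : Q.IsSymm) (hu : IsUnit Q) :
    Module.finrank ℝ (skewAdjointMatricesSubmodule Q) + (d + 1).choose 2 =
      Module.finrank ℝ (Matrix (Fin d) (Fin d) ℝ) := by
  have h := (symmetrizedMul hQ).finrank_range_add_finrank_ker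
  rw [LinearMap.range_eq_top.2 (symmetrizedMul_surjective hQ hu), finrank_top,
    Module.finrank_fintype_fun_eq_card, Sym2.card, Fintype.card_fin, ker_symmetrizedMul] at h
  rw [← h, add_comm]

theorem one_notMem_skewAdjoint (h0 : Q ≠ 0) : 1 ∉ skewAdjointMatricesSubmodule Q := by
  rw [mem_skewAdjoint_iff, transpose_one, one_mul, mul_one]
  intro h
  refine h0 (Matrix.ext fun i j => ?_)
  have := congrFun (congrFun h i) j
  rw [neg_apply] at this
  rw [Matrix.zero_apply]
  linarith

theorem finrank_symAlg_add (hQ : Q.IsSymm) (hu : IsUnit Q) {u v : Fin d → ℝ}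
    (hup : 0 < toBilin' Q u u) (hvn : toBilin' Q v v < 0) :
    Module.finrank ℝ (symAlg (quadricCone Q)) + ((d + 1).choose 2 - 1) =
      Module.finrank ℝ (Matrix (Fin d) (Fin d) ℝ) := by
  have h0 : Q ≠ 0 := by
    rintro rfl
    simp at hup
  have hd : Disjoint (skewAdjointMatricesSubmodule Q) (Submodule.span ℝ {1}) := by
    rw [Submodule.disjoint_span_singleton]
    exact fun h => absurd h (one_notMem_skewAdjoint h0)
  have h1 := Submodule.finrank_sup_add_finrank_inf_eq (skewAdjointMatricesSubmodule Q)
    (Submodule.span ℝ {1})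
  have hd0 : d ≠ 0 := by
    rintro rfl
    exact h0 (Subsingleton.elim _ _)
  have : Nonempty (Fin d) := ⟨⟨0, Nat.pos_of_ne_zero hd0⟩⟩
  rw [hd.eq_bot, finrank_bot, finrank_span_singleton one_ne_zero] at h1
  have h2 := finrank_skewAdjoint_add hQ hu
  have h3 : 0 < (d + 1).choose 2 := Nat.choose_pos (by omega)
  rw [symAlg_quadricCone_eq hQ hu hup hvn]
  omega

theorem nStar_quadricCone (hQ : Q.IsSymm) (hu : IsUnit Q) {u v : Fin d → ℝ}
    (hup : 0 < toBilin' Q u u) (hvn : toBilin' Q v v < 0) :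
    nStar (quadricCone Q) = ((d + 1).choose 2 - 1 : ℕ) := by
  have h1 := finrank_symAlg_add hQ hu hup hvn
  have h2 := (symAlg (quadricCone Q)).finrank_quotient_add_finrank
  have h3 : Module.finrank ℝ (Matrix (Fin d) (Fin d) ℝ ⧸ symAlg (quadricCone Q)) =
    (d + 1).choose 2 - 1 := by omega
  rw [nStar, h3, submanifoldCodim_quadricCone hQ hu (quadricCone_nonempty hQ hup hvn)]
  simp

end Signs

/-! ### Linear functionals attached to points of the cone -/

section Generic

open Matrix

variable {d : ℕ} {Q : Matrix (Fin d) (Fin d) ℝ}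

/-- The linear functional on matrices whose coefficient at the entry `(i, j)` is `v i j`. -/
def entryFunctional (d : ℕ) :
    (Fin d → Fin d → ℝ) →ₗ[ℝ] Module.Dual ℝ (Matrix (Fin d) (Fin d) ℝ) :=
  LinearMap.mk₂ ℝ (fun v A => ∑ i, ∑ j, v i j * A i j)
    (fun _ _ _ => by simp [add_mul, Finset.sum_add_distrib])
    (fun _ _ _ => by simp [Finset.mul_sum, mul_assoc])
    (fun _ _ _ => by simp [mul_add, Finset.sum_add_distrib])
    (fun _ _ _ => by simp [Finset.mul_sum, mul_left_comm])

theorem ker_entryFunctional : LinearMap.ker (entryFunctional d) = ⊥ := by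
  rw [LinearMap.ker_eq_bot']
  intro v hv
  ext i j
  have := LinearMap.congr_fun hv (Matrix.single i j 1)
  simpa [entryFunctional, LinearMap.mk₂_apply, Matrix.single_apply, Finset.sum_ite, ite_and]
    using this

/-- The coefficients of the functional `A ↦ xᵀ Q A x`. -/
def stabCoeff (Q : Matrix (Fin d) (Fin d) ℝ) (x : Fin d → ℝ) : Fin d → Fin d → ℝ :=
  fun i j => (Q *ᵥ x) i * x j

/-- The functional `A ↦ xᵀ Q A x`, which cuts out `S_x M` for `x` in the cone `M`. -/
def stabFunctional (Q : Matrix (Fin d) (Fin d) ℝ) (x : Fin d → ℝ) :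
    Module.Dual ℝ (Matrix (Fin d) (Fin d) ℝ) :=
  entryFunctional d (stabCoeff Q x)

theorem stabFunctional_apply (hQ : Q.IsSymm) (x : Fin d → ℝ) (A : Matrix (Fin d) (Fin d) ℝ) :
    stabFunctional Q x A = toBilin' Q x (A *ᵥ x) := by
  rw [toBilin'_comm hQ, toBilin'_apply', dotProduct_comm]
  simp only [stabFunctional, entryFunctional, stabCoeff, LinearMap.mk₂_apply, dotProduct]
  refine Finset.sum_congr rfl fun i _ => ?_
  rw [mulVec, mulVec, dotProduct, dotProduct, Finset.mul_sum]
  exact Finset.sum_congr rfl fun j _ => by ring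

theorem linearIndependent_stabFunctional_iff {n : ℕ} {x : Fin n → Fin d → ℝ} :
    LinearIndependent ℝ (fun i => stabFunctional Q (x i)) ↔
      LinearIndependent ℝ (fun i => stabCoeff Q (x i)) :=
  (entryFunctional d).linearIndependent_iff ker_entryFunctional

theorem isOpen_setOf_linearIndependent_stabFunctional {M : Set (Fin d → ℝ)} (n : ℕ) :
    IsOpen {x : Fin n → M | LinearIndependent ℝ fun i => stabFunctional Q (x i)} := by
  simp only [linearIndependent_stabFunctional_iff]
  have hc : Continuous (stabCoeff Q) := by
    unfold stabCoeff mulVec dotProduct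
    fun_prop
  exact isOpen_setOfPred_linearIndependent.preimage
    (f := fun (x : Fin n → M) i => stabCoeff Q (x i)) (by fun_prop)

/-- The subspace of matrices on which the functionals of all points of a tuple vanish. -/
def jointKer (Q : Matrix (Fin d) (Fin d) ℝ) {n : ℕ} (x : Fin n → Fin d → ℝ) :
    Submodule ℝ (Matrix (Fin d) (Fin d) ℝ) :=
  (Submodule.span ℝ (Set.range fun i => stabFunctional Q (x i))).dualCoannihilator

theorem mem_jointKer_iff (hQ : Q.IsSymm) {n : ℕ} {x : Fin n → Fin d → ℝ}
    {A : Matrix (Fin d) (Fin d) ℝ} :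
    A ∈ jointKer Q x ↔ ∀ i, toBilin' Q (x i) (A *ᵥ x i) = 0 := by
  rw [jointKer, Submodule.mem_dualCoannihilator]
  constructor
  · intro h i
    rw [← stabFunctional_apply hQ]
    exact h _ (Submodule.subset_span ⟨i, rfl⟩)
  · intro h φ hφ
    have h1 : Submodule.span ℝ (Set.range fun i => stabFunctional Q (x i)) ≤
        LinearMap.ker (Module.Dual.eval ℝ _ A) := by
      rw [Submodule.span_le]
      rintro _ ⟨i, rfl⟩
      simpa [stabFunctional_apply hQ] using h i
    simpa using h1 hφ

theorem iInter_tangentStab_eq_jointKer (hQ : Q.IsSymm) (hu : IsUnit Q) {n : ℕ}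
    (x : Fin n → quadricCone Q) :
    ⋂ i, tangentStab (quadricCone Q) (x i : Fin d → ℝ) =
      jointKer Q fun i => (x i : Fin d → ℝ) := by
  ext A
  simp only [Set.mem_iInter, SetLike.mem_coe, mem_jointKer_iff hQ,
    mem_tangentStab_quadricCone_iff hQ hu (x _).2]

theorem finrank_span_add_finrank_jointKer {n : ℕ} (x : Fin n → Fin d → ℝ) :
    Module.finrank ℝ (Submodule.span ℝ (Set.range fun i => stabFunctional Q (x i))) +
      Module.finrank ℝ (jointKer Q x) = Module.finrank ℝ (Matrix (Fin d) (Fin d) ℝ) :=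
  Subspace.finrank_add_finrank_dualCoannihilator_eq _

theorem symAlg_le_jointKer (hQ : Q.IsSymm) (hu : IsUnit Q) {n : ℕ} (x : Fin n → quadricCone Q) :
    symAlg (quadricCone Q) ≤ jointKer Q fun i => (x i : Fin d → ℝ) := fun _ hA =>
  (mem_jointKer_iff hQ).2 fun i => (mem_tangentStab_quadricCone_iff hQ hu (x i).2).1
    (mem_tangentStab_of_mem_symAlg hA (x i).2)

/-! ### Generic points determine the Lie algebra in dimension at least three -/

/-- The orthogonal complement of a hyperbolic pair contains an anisotropic vector, because it is a
nonzero nondegenerate space. -/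
theorem exists_orthogonal_anisotropic (hQ : Q.IsSymm) (hu : IsUnit Q) (hd : 3 ≤ d)
    {x y : Fin d → ℝ} (hx : toBilin' Q x x = 0) (hy : toBilin' Q y y = 0)
    (hxy : toBilin' Q x y = 1) :
    ∃ w, toBilin' Q x w = 0 ∧ toBilin' Q y w = 0 ∧ toBilin' Q w w ≠ 0 := by
  by_contra! h
  obtain ⟨w, hw, hw0⟩ : ∃ w, (toBilin' Q x).prod (toBilin' Q y) w = 0 ∧ w ≠ 0 := by
    by_contra! hinj
    have := LinearMap.finrank_le_finrank_of_injective
      (LinearMap.ker_eq_bot.1 (LinearMap.ker_eq_bot'.2 hinj))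
    simp at this
    omega
  have hw1 : toBilin' Q x w = 0 := congrArg Prod.fst hw
  have hw2 : toBilin' Q y w = 0 := congrArg Prod.snd hw
  obtain ⟨z, hz⟩ := exists_toBilin'_ne_zero hQ hu hw0
  -- replace `z` by its component orthogonal to `x` and `y`
  set z' := z - toBilin' Q y z • x - toBilin' Q x z • y with hz'
  have h1 : toBilin' Q x z' = 0 := by simp [hz', hx, hxy]
  have h2 : toBilin' Q y z' = 0 := by simp [hz', hy, toBilin'_comm hQ y x, hxy]
  have h3 : toBilin' Q w z' = toBilin' Q w z := by
    simp [hz', toBilin'_comm hQ w x, toBilin'_comm hQ w y, hw1, hw2]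
  have h4 := h (w + z') (by simp [hw1, h1]) (by simp [hw2, h2])
  simp only [map_add, LinearMap.add_apply, h w hw1 hw2, h z' h1 h2, toBilin'_comm hQ z' w, h3]
    at h4
  exact hz (by linarith)

/-- In dimension at least three, the tangency condition on a nonempty open part of the cone
characterises its Lie algebra. -/
theorem mem_symAlg_of_forall_mem_open (hQ : Q.IsSymm) (hu : IsUnit Q) (hd : 3 ≤ d)
    {u v : Fin d → ℝ} (hup : 0 < toBilin' Q u u) (hvn : toBilin' Q v v < 0)
    {U : Set (quadricCone Q)} (hU : IsOpen U) (hne : U.Nonempty) {A : Matrix (Fin d) (Fin d) ℝ}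
    (hA : ∀ x ∈ U, toBilin' Q (x : Fin d → ℝ) (A *ᵥ x) = 0) : A ∈ symAlg (quadricCone Q) := by
  obtain ⟨⟨x, hx⟩, hxU⟩ := hne
  obtain ⟨U', hU', rfl⟩ := isOpen_induced_iff.1 hU
  obtain ⟨y, hy, hxy⟩ := exists_hyperbolic_partner hQ hu hx
  have hxx := (mem_quadricCone_iff.1 hx).2
  have hS := toBilin'_comm (isSymm_mul_add_transpose_mul hQ A)
  rw [symAlg_quadricCone_eq hQ hu hup hvn]
  refine mem_skewAdjoint_sup_of_apply_self_eq hQ (apply_self_eq_mul_of_eventually_isotropic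
    (toBilin'_comm hQ) hS hxx hy hxy (exists_orthogonal_anisotropic hQ hu hd hxx hy hxy)
    fun w hxw hyw => ?_)
  have hc : Tendsto (fun t : ℝ => x + t • w - (t ^ 2 * toBilin' Q w w / 2) • y) (𝓝 0) (𝓝 x) := by
    have : ContinuousAt (fun t : ℝ => x + t • w - (t ^ 2 * toBilin' Q w w / 2) • y) 0 := by
      fun_prop
    simpa [ContinuousAt] using this
  filter_upwards [hc.eventually (hU'.mem_nhds hxU)] with t ht
  have hM : x + t • w - (t ^ 2 * toBilin' Q w w / 2) • y ∈ quadricCone Q := by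
    rw [mem_quadricCone_iff]
    constructor
    · intro h0
      have h1 := congrArg (fun z => toBilin' Q y z) h0
      simp [toBilin'_comm hQ y x, hxy, hyw, hy] at h1
    · simp only [map_add, map_sub, map_smul, LinearMap.add_apply, LinearMap.sub_apply,
        LinearMap.smul_apply, smul_eq_mul, toBilin'_comm hQ w x, toBilin'_comm hQ y x,
        toBilin'_comm hQ w y, hxx, hxy, hy, hxw, hyw]
      ring
  rw [toBilin'_mul_add_transpose_mul hQ, hA ⟨_, hM⟩ ht, mul_zero]

/-- As long as there are fewer points than the codimension of the Lie algebra, a further point with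
independent functional exists in every nonempty open part of the cone. -/
theorem exists_stabFunctional_notMem_span (hQ : Q.IsSymm) (hu : IsUnit Q) (hd : 3 ≤ d)
    {u v : Fin d → ℝ} (hup : 0 < toBilin' Q u u) (hvn : toBilin' Q v v < 0)
    {U : Set (quadricCone Q)} (hU : IsOpen U) (hne : U.Nonempty) {n : ℕ}
    (hn : n < (d + 1).choose 2 - 1) (y : Fin n → Fin d → ℝ) :
    ∃ x ∈ U, stabFunctional Q x ∉
      Submodule.span ℝ (Set.range fun i => stabFunctional Q (y i)) := by
  by_contra! h
  have h1 : jointKer Q y ≤ symAlg (quadricCone Q) := fun A hA =>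
    mem_symAlg_of_forall_mem_open hQ hu hd hup hvn hU hne fun x hx => by
      rw [← stabFunctional_apply hQ]
      exact (Submodule.mem_dualCoannihilator _).1 hA _ (h x hx)
  have h2 := Submodule.finrank_mono h1
  have h3 := finrank_span_add_finrank_jointKer (Q := Q) y
  have h4 := finrank_symAlg_add hQ hu hup hvn
  have h5 := finrank_range_le_card (R := ℝ) (fun i => stabFunctional Q (y i))
  rw [Fintype.card_fin, Set.finrank] at h5
  omega

theorem exists_linearIndependent_stabFunctional (hQ : Q.IsSymm) (hu : IsUnit Q) (hd : 3 ≤ d)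
    {u v : Fin d → ℝ} (hup : 0 < toBilin' Q u u) (hvn : toBilin' Q v v < 0) (n : ℕ)
    (hn : n ≤ (d + 1).choose 2 - 1) (U : Fin n → Set (quadricCone Q)) (hU : ∀ i, IsOpen (U i))
    (hne : ∀ i, (U i).Nonempty) : ∃ x : Fin n → quadricCone Q, (∀ i, x i ∈ U i) ∧
      LinearIndependent ℝ fun i => stabFunctional Q (x i) := by
  induction n with
  | zero => exact ⟨Fin.elim0, fun i => i.elim0, linearIndependent_empty_type⟩
  | succ n ih =>
    obtain ⟨x, hx, hli⟩ := ih (by omega) (fun i => U i.castSucc) (fun i => hU _) (fun i => hne _)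
    obtain ⟨z, hz, hzn⟩ := exists_stabFunctional_notMem_span hQ hu hd hup hvn (hU (Fin.last n))
      (hne _) (by omega) fun i => (x i : Fin d → ℝ)
    refine ⟨Fin.snoc x z, Fin.lastCases (by simpa using hz) (fun i => by simpa using hx i), ?_⟩
    have hs : (fun i => stabFunctional Q (Fin.snoc (α := fun _ => quadricCone Q) x z i)) =
        Fin.snoc (fun i => stabFunctional Q (x i)) (stabFunctional Q z) := by
      ext i : 1
      refine Fin.lastCases ?_ (fun i => ?_) i <;> simp
    rw [hs]
    exact hli.finSnoc hzn

theorem dense_setOf_linearIndependent_stabFunctional (hQ : Q.IsSymm) (hu : IsUnit Q) (hd : 3 ≤ d)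
    {u v : Fin d → ℝ} (hup : 0 < toBilin' Q u u) (hvn : toBilin' Q v v < 0) {n : ℕ}
    (hn : n ≤ (d + 1).choose 2 - 1) :
    Dense {x : Fin n → quadricCone Q | LinearIndependent ℝ fun i => stabFunctional Q (x i)} := by
  rw [dense_iff_inter_open]
  rintro W hW ⟨x, hx⟩
  obtain ⟨U, hU, hUW⟩ := isOpen_pi_iff'.1 hW x hx
  obtain ⟨z, hz, hli⟩ := exists_linearIndependent_stabFunctional hQ hu hd hup hvn n hn U
    (fun i => (hU i).1) fun i => ⟨x i, (hU i).2⟩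
  exact ⟨z, hUW fun i _ => hz i, hli⟩

theorem nCirc_quadricCone_of_three_le (hQ : Q.IsSymm) (hu : IsUnit Q) (hd : 3 ≤ d)
    {u v : Fin d → ℝ} (hup : 0 < toBilin' Q u u) (hvn : toBilin' Q v v < 0) :
    nCirc (quadricCone Q) = (((d + 1).choose 2 - 1 : ℕ) : ℕ∞) := by
  have h1 := finrank_symAlg_add hQ hu hup hvn
  apply le_antisymm
  · refine iInf₂_le _ ⟨_, isOpen_setOf_linearIndependent_stabFunctional _,
      dense_setOf_linearIndependent_stabFunctional hQ hu hd hup hvn le_rfl, fun x hx => ?_⟩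
    rw [iInter_tangentStab_eq_jointKer hQ hu, SetLike.coe_set_eq]
    refine Submodule.eq_of_le_of_finrank_eq (symAlg_le_jointKer hQ hu x) ?_
    have h2 := finrank_span_add_finrank_jointKer (Q := Q) fun i => (x i : Fin d → ℝ)
    rw [finrank_span_eq_card hx, Fintype.card_fin] at h2
    omega
  · refine le_iInf₂ fun n hn => ?_
    obtain ⟨O, -, hO, hOx⟩ := hn
    have : Nonempty (quadricCone Q) := (quadricCone_nonempty hQ hup hvn).to_subtype
    obtain ⟨x, hx⟩ := hO.nonempty
    have h2 := hOx x hx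
    rw [iInter_tangentStab_eq_jointKer hQ hu, SetLike.coe_set_eq] at h2
    have h3 := finrank_span_add_finrank_jointKer (Q := Q) fun i => (x i : Fin d → ℝ)
    have h4 := finrank_range_le_card (R := ℝ) fun i => stabFunctional Q (x i : Fin d → ℝ)
    rw [Fintype.card_fin, Set.finrank] at h4
    rw [h2] at h1
    exact_mod_cast (by omega : (d + 1).choose 2 - 1 ≤ n)

end Generic

/-! ### The plane -/

section Plane

open Matrix

theorem eq_smul_add_smul_of_hyperbolic {Q : Matrix (Fin 2) (Fin 2) ℝ} (hQ : Q.IsSymm)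
    {u v : Fin 2 → ℝ} (hu : toBilin' Q u u = 0) (hv : toBilin' Q v v = 0)
    (huv : toBilin' Q u v = 1) (x : Fin 2 → ℝ) :
    x = toBilin' Q x v • u + toBilin' Q x u • v := by
  have hli : LinearIndependent ℝ ![u, v] := by
    rw [LinearIndependent.pair_iff]
    intro s t h
    have h1 := congrArg (fun z => toBilin' Q u z) h
    have h2 := congrArg (fun z => toBilin' Q v z) h
    simp [hu, hv, huv, toBilin'_comm hQ v u] at h1 h2
    exact ⟨h2, h1⟩
  have hx : x ∈ Submodule.span ℝ (Set.range ![u, v]) := by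
    rw [hli.span_eq_top_of_card_eq_finrank (by simp)]
    trivial
  rw [Matrix.range_cons_cons_empty, Submodule.mem_span_pair] at hx
  obtain ⟨a, b, rfl⟩ := hx
  simp [hu, hv, huv, toBilin'_comm hQ v u]

/-- In the plane, the cone consists of two lines without the origin. Tuples of points on one of
these lines are an open set of tuples, and do not see the other line. -/
theorem nCirc_quadricCone_two {Q : Matrix (Fin 2) (Fin 2) ℝ} (hQ : Q.IsSymm) (hQu : IsUnit Q)
    (hne : (quadricCone Q).Nonempty) : nCirc (quadricCone Q) = ⊤ := by
  obtain ⟨u, hu⟩ := hne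
  obtain ⟨v, hv, huv⟩ := exists_hyperbolic_partner hQ hQu hu
  have huu := (mem_quadricCone_iff.1 hu).2
  have hvM : v ∈ quadricCone Q := by
    refine mem_quadricCone_iff.2 ⟨?_, hv⟩
    rintro rfl
    simp at huv
  rw [nCirc, iInf_eq_top]
  intro n
  rw [iInf_eq_top]
  rintro ⟨O, -, hO, hOx⟩
  exfalso
  have hcont : Continuous fun x : Fin 2 → ℝ => toBilin' Q x v := by
    simp only [toBilin'_apply', dotProduct]
    fun_prop
  have hW : IsOpen {x : Fin n → quadricCone Q | ∀ i, toBilin' Q (x i : Fin 2 → ℝ) v ≠ 0} := by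
    rw [Set.ofPred_forall]
    refine isOpen_iInter_of_finite fun i => ?_
    exact isOpen_compl_singleton.preimage
      (f := fun x : Fin n → quadricCone Q => toBilin' Q (x i : Fin 2 → ℝ) v)
      (hcont.comp (continuous_subtype_val.comp (continuous_apply i)))
  obtain ⟨x, hxW, hxO⟩ := hO.inter_open_nonempty _ hW
    ⟨fun _ => ⟨u, hu⟩, fun _ => by simp [huv]⟩
  -- the matrix of `x ↦ ⟨u, x⟩ u` annihilates the line of `u`, and sends `v` to `u`
  have hA (z : Fin 2 → ℝ) : vecMulVec u (Q *ᵥ u) *ᵥ z = toBilin' Q z u • u := by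
    rw [toBilin'_apply', vecMulVec_mulVec, dotProduct_comm, op_smul_eq_smul]
  have hmem : vecMulVec u (Q *ᵥ u) ∈ ⋂ i, tangentStab (quadricCone Q) (x i : Fin 2 → ℝ) := by
    refine Set.mem_iInter.2 fun i => ?_
    rw [mem_tangentStab_quadricCone_iff hQ hQu (x i).2, hA]
    have h1 := eq_smul_add_smul_of_hyperbolic hQ huu hv huv (x i)
    have h2 := (mem_quadricCone_iff.1 (x i).2).2
    have h3 : toBilin' Q (x i : Fin 2 → ℝ) u = 0 := by
      have h4 : 2 * toBilin' Q (x i : Fin 2 → ℝ) v * toBilin' Q (x i : Fin 2 → ℝ) u = 0 := by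
        nth_rw 2 [h1] at h2
        simp only [map_add, map_smul, smul_eq_mul] at h2
        linear_combination h2
      exact (mul_eq_zero.1 h4).resolve_left (mul_ne_zero two_ne_zero (hxW i))
    rw [h3, zero_smul, map_zero]
  rw [← hOx x hxO] at hmem
  have h5 := (mem_tangentStab_quadricCone_iff hQ hQu hvM).1
    (mem_tangentStab_of_mem_symAlg hmem hvM)
  rw [hA, toBilin'_comm hQ v u, huv, one_smul, toBilin'_comm hQ v u, huv] at h5
  exact one_ne_zero h5

end Plane

/-! ### Sylvester's normal form -/

section Sylvester

open Matrix

variable {d : ℕ} {Q : Matrix (Fin d) (Fin d) ℝ}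

theorem exists_eq_transpose_mul_diagonal_mul (hQ : Q.IsSymm) (hu : IsUnit Q) :
    ∃ (w : Fin d → ℝ) (P R : Matrix (Fin d) (Fin d) ℝ), (∀ i, w i = -1 ∨ w i = 1) ∧
      P * R = 1 ∧ R * P = 1 ∧ Q = Pᵀ * diagonal w * P := by
  have hdet : IsUnit Q.det := (isUnit_iff_isUnit_det Q).1 hu
  have hass : QuadraticMap.associated (R := ℝ) (toBilin' Q).toQuadraticMap = toBilin' Q :=
    QuadraticMap.associated_left_inverse ℝ (fun x y => toBilin'_comm hQ x y)
  have hsep : (QuadraticMap.associated (R := ℝ)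
      (toBilin' Q).toQuadraticMap).SeparatingLeft := by
    rw [hass]
    intro x hx
    by_contra h0
    obtain ⟨z, hz⟩ := exists_toBilin'_ne_zero hQ hu h0
    exact hz (hx z)
  obtain ⟨w, hw, ⟨e⟩⟩ :=
    QuadraticForm.equivalent_one_neg_one_weighted_sum_squared _ hsep
  have hd : d = Module.finrank ℝ (Fin d → ℝ) := by simp
  let σ := finCongr hd
  let e' : (Fin d → ℝ) ≃ₗ[ℝ] (Fin d → ℝ) := e.toLinearEquiv.trans (LinearEquiv.funCongrLeft ℝ ℝ σ)
  refine ⟨w ∘ σ, LinearMap.toMatrix' e'.toLinearMap, LinearMap.toMatrix' e'.symm.toLinearMap,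
    fun i => hw _, ?_, ?_, ?_⟩
  · rw [← LinearMap.toMatrix'_comp]
    simp
  · rw [← LinearMap.toMatrix'_comp]
    simp
  · refine hQ.eq_of_toBilin'_self ?_ fun x => ?_
    · rw [Matrix.IsSymm, transpose_mul, transpose_mul, transpose_transpose, diagonal_transpose,
        mul_assoc]
    · have h1 : toBilin' ((LinearMap.toMatrix' e'.toLinearMap)ᵀ * diagonal (w ∘ σ) *
          LinearMap.toMatrix' e'.toLinearMap) x x = toBilin' (diagonal (w ∘ σ)) (e' x) (e' x) := by
        simp only [toBilin'_apply', ← mulVec_mulVec, LinearMap.toMatrix'_mulVec]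
        rw [dotProduct_mulVec x, vecMul_transpose, LinearMap.toMatrix'_mulVec]
        rfl
      have h2 : toBilin' Q x x = QuadraticMap.weightedSumSquares ℝ w (e x) := (e.map_app x).symm
      rw [h1, h2, QuadraticMap.weightedSumSquares_apply, toBilin'_apply', dotProduct,
        ← σ.sum_comp]
      refine Finset.sum_congr rfl fun i _ => ?_
      rw [mulVec_diagonal]
      change w (σ i) * (e x (σ i) * e x (σ i)) = e x (σ i) * (w (σ i) * e x (σ i))
      ring

theorem exists_isSylvesterForm (hQ : Q.IsSymm) (hu : IsUnit Q) :
    ∃ (p q : ℕ) (P : Matrix (Fin p ⊕ Fin q) (Fin d) ℝ) (R : Matrix (Fin d) (Fin p ⊕ Fin q) ℝ),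
      IsSylvesterForm Q P R := by
  classical
  obtain ⟨w, P, R, hw, hPR, hRP, hQP⟩ := exists_eq_transpose_mul_diagonal_mul hQ hu
  let σ : Fin (Fintype.card {i // w i = 1}) ⊕ Fin (Fintype.card {i // ¬ w i = 1}) ≃ Fin d :=
    (Equiv.sumCongr (Fintype.equivFin _).symm (Fintype.equivFin _).symm).trans
      (Equiv.sumCompl fun i => w i = 1)
  have hσ : LieAlgebra.Orthogonal.indefiniteDiagonal (Fin (Fintype.card {i // w i = 1}))
      (Fin (Fintype.card {i // ¬ w i = 1})) ℝ = (diagonal w).submatrix σ σ := by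
    rw [submatrix_diagonal_equiv, LieAlgebra.Orthogonal.indefiniteDiagonal]
    congr 1
    ext (i | i)
    · exact (((Fintype.equivFin {i // w i = 1}).symm i).2).symm
    · exact ((hw _).resolve_right ((Fintype.equivFin {i // ¬ w i = 1}).symm i).2).symm
  refine ⟨_, _, P.submatrix σ id, R.submatrix id σ, ?_, ?_, ?_⟩
  · rw [← submatrix_mul _ _ _ _ _ Function.bijective_id, hPR, submatrix_one_equiv]
  · rw [submatrix_mul_equiv, hRP, submatrix_id_id]
  · rw [hσ, transpose_submatrix, submatrix_mul_equiv, submatrix_mul_equiv, submatrix_id_id, hQP]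

theorem IsSylvesterForm.toBilin'_self {p q : ℕ} {P : Matrix (Fin p ⊕ Fin q) (Fin d) ℝ}
    {R : Matrix (Fin d) (Fin p ⊕ Fin q) ℝ} (h : IsSylvesterForm Q P R) (x : Fin d → ℝ) :
    toBilin' Q x x = ∑ i, (P *ᵥ x) (Sum.inl i) ^ 2 - ∑ i, (P *ᵥ x) (Sum.inr i) ^ 2 := by
  rw [toBilin'_apply', h.2.2, ← mulVec_mulVec, ← mulVec_mulVec, dotProduct_mulVec x,
    vecMul_transpose, dotProduct, Fintype.sum_sum_type]
  simp only [LieAlgebra.Orthogonal.indefiniteDiagonal, mulVec_diagonal, Sum.elim_inl, Sum.elim_inr]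
  simp [sq, ← sub_eq_add_neg]

theorem IsSylvesterForm.pos_left {p q : ℕ} {P : Matrix (Fin p ⊕ Fin q) (Fin d) ℝ}
    {R : Matrix (Fin d) (Fin p ⊕ Fin q) ℝ} (h : IsSylvesterForm Q P R) {u : Fin d → ℝ}
    (hup : 0 < toBilin' Q u u) : 0 < p := by
  refine Nat.pos_of_ne_zero ?_
  rintro rfl
  rw [h.toBilin'_self, Fintype.sum_empty] at hup
  linarith [Finset.sum_nonneg fun i (_ : i ∈ Finset.univ) => sq_nonneg ((P *ᵥ u) (Sum.inr i))]

theorem IsSylvesterForm.pos_right {p q : ℕ} {P : Matrix (Fin p ⊕ Fin q) (Fin d) ℝ}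
    {R : Matrix (Fin d) (Fin p ⊕ Fin q) ℝ} (h : IsSylvesterForm Q P R) {v : Fin d → ℝ}
    (hvn : toBilin' Q v v < 0) : 0 < q := by
  refine Nat.pos_of_ne_zero ?_
  rintro rfl
  rw [h.toBilin'_self, Fintype.sum_empty (ι := Fin 0)] at hvn
  linarith [Finset.sum_nonneg fun i (_ : i ∈ Finset.univ) => sq_nonneg ((P *ᵥ v) (Sum.inl i))]

theorem IsSylvesterForm.mem_so'_iff {p q : ℕ} {P : Matrix (Fin p ⊕ Fin q) (Fin d) ℝ}
    {R : Matrix (Fin d) (Fin p ⊕ Fin q) ℝ} (h : IsSylvesterForm Q P R)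
    {W : Matrix (Fin p ⊕ Fin q) (Fin p ⊕ Fin q) ℝ} :
    W ∈ LieAlgebra.Orthogonal.so' (Fin p) (Fin q) ℝ ↔
      R * W * P ∈ skewAdjointMatricesSubmodule Q := by
  obtain ⟨hPR, hRP, hQ⟩ := h
  rw [LieAlgebra.Orthogonal.so', mem_skewAdjointMatricesLieSubalgebra,
    mem_skewAdjointMatricesSubmodule, Matrix.IsSkewAdjoint, Matrix.IsAdjointPair,
    mem_skewAdjoint_iff, mul_neg]
  set J := LieAlgebra.Orthogonal.indefiniteDiagonal (Fin p) (Fin q) ℝ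
  have h1 : (R * W * P)ᵀ * Q = Pᵀ * (Wᵀ * J) * P := by
    have hRPt : Rᵀ * Pᵀ = 1 := by rw [← transpose_mul, hPR, transpose_one]
    calc (R * W * P)ᵀ * Q = Pᵀ * Wᵀ * (Rᵀ * Pᵀ) * J * P := by
          simp only [hQ, transpose_mul, Matrix.mul_assoc]
      _ = _ := by rw [hRPt]; simp only [Matrix.mul_one, Matrix.mul_assoc]
  have h2 : Q * (R * W * P) = Pᵀ * (J * W) * P := by
    calc Q * (R * W * P) = Pᵀ * J * (P * R) * W * P := by
          simp only [hQ, Matrix.mul_assoc]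
      _ = _ := by rw [hPR]; simp only [Matrix.mul_one, Matrix.mul_assoc]
  have h4 : -(Pᵀ * (J * W) * P) = Pᵀ * -(J * W) * P := by
    rw [Matrix.mul_neg, Matrix.neg_mul]
  rw [h1, h2, h4]
  refine ⟨fun h => by rw [h], fun h => ?_⟩
  have h3 (X : Matrix (Fin p ⊕ Fin q) (Fin p ⊕ Fin q) ℝ) : Rᵀ * (Pᵀ * X * P) * R = X := by
    calc Rᵀ * (Pᵀ * X * P) * R = (P * R)ᵀ * X * (P * R) := by
          simp only [transpose_mul, Matrix.mul_assoc]
      _ = X := by rw [hPR, transpose_one, Matrix.one_mul, Matrix.mul_one]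
  rw [← h3 (Wᵀ * J), h, h3]

theorem IsSylvesterForm.skewAdjoint_sup_eq {p q : ℕ} {P : Matrix (Fin p ⊕ Fin q) (Fin d) ℝ}
    {R : Matrix (Fin d) (Fin p ⊕ Fin q) ℝ} (h : IsSylvesterForm Q P R) :
    ((skewAdjointMatricesSubmodule Q ⊔ Submodule.span ℝ {1} :
      Submodule ℝ (Matrix (Fin d) (Fin d) ℝ)) : Set (Matrix (Fin d) (Fin d) ℝ)) =
      {Z | ∃ W ∈ LieAlgebra.Orthogonal.so' (Fin p) (Fin q) ℝ, ∃ β : ℝ,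
        Z = R * W * P + β • (1 : Matrix (Fin d) (Fin d) ℝ)} := by
  ext Z
  rw [SetLike.mem_coe, Submodule.mem_sup]
  constructor
  · rintro ⟨A, hA, C, hC, rfl⟩
    obtain ⟨β, rfl⟩ := Submodule.mem_span_singleton.1 hC
    have h1 : R * (P * A * R) * P = A := by
      calc R * (P * A * R) * P = (R * P) * A * (R * P) := by simp only [Matrix.mul_assoc]
        _ = A := by rw [h.2.1, Matrix.one_mul, Matrix.mul_one]
    exact ⟨P * A * R, h.mem_so'_iff.2 (by rwa [h1]), β, by rw [h1]⟩
  · rintro ⟨W, hW, β, rfl⟩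
    exact ⟨_, h.mem_so'_iff.1 hW, _,
      Submodule.smul_mem _ β (Submodule.mem_span_singleton_self _), rfl⟩

end Sylvester

/-! ### Symmetries and tangent spaces of an indefinite cone -/

theorem mainTheorem2 (d : ℕ) (Q : Matrix (Fin d) (Fin d) ℝ) (hsymm : Q.IsSymm)
    (hrank : Q.rank = d) :
    (quadricCone Q = ∅ ↔ Q.PosDef ∨ (-Q).PosDef) ∧
    (¬ (Q.PosDef ∨ (-Q).PosDef) →
      IsSubmanifoldOfCodim (quadricCone Q) 1 ∧
      (d = 2 → nStar (quadricCone Q) = 2 ∧ nCirc (quadricCone Q) = ⊤) ∧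
      (d ≠ 2 → nCirc (quadricCone Q) = (((d + 1).choose 2 - 1 : ℕ) : ℕ∞) ∧
        nStar (quadricCone Q) = ((d + 1).choose 2 : ℚ) - 1) ∧
      symAlg (quadricCone Q) =
        skewAdjointMatricesSubmodule Q ⊔ Submodule.span ℝ {1} ∧
      (∃ (p q : ℕ) (P : Matrix (Fin p ⊕ Fin q) (Fin d) ℝ)
        (R : Matrix (Fin d) (Fin p ⊕ Fin q) ℝ), 0 < p ∧ 0 < q ∧ IsSylvesterForm Q P R) ∧
      ∀ (p q : ℕ) (P : Matrix (Fin p ⊕ Fin q) (Fin d) ℝ)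
        (R : Matrix (Fin d) (Fin p ⊕ Fin q) ℝ), IsSylvesterForm Q P R →
        (symAlg (quadricCone Q) : Set (Matrix (Fin d) (Fin d) ℝ)) =
          {Z | ∃ W ∈ LieAlgebra.Orthogonal.so' (Fin p) (Fin q) ℝ, ∃ β : ℝ,
            Z = R * W * P + β • (1 : Matrix (Fin d) (Fin d) ℝ)}) := by
  have hu := isUnit_of_rank_eq hrank
  refine ⟨quadricCone_eq_empty_iff hsymm hu, fun hdef => ?_⟩
  obtain ⟨hpd, hnd⟩ := not_or.1 hdef
  obtain ⟨v, hv⟩ := exists_toBilin'_neg_of_not_posDef hsymm hu hpd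
  obtain ⟨u, hup⟩ := exists_toBilin'_pos_of_not_posDef_neg hsymm hu hnd
  have hne := quadricCone_nonempty hsymm hup hv
  have hstar := nStar_quadricCone hsymm hu hup hv
  -- both inertia indices are positive, and their sum is at most `d`
  have hd1 : 2 ≤ d := by
    obtain ⟨p, q, P, R, h⟩ := exists_isSylvesterForm hsymm hu
    have hp := h.pos_left hup
    have hq := h.pos_right hv
    have hcard : p + q ≤ d := by
      have h1 := (Matrix.rank_mul_le_left P R).trans P.rank_le_card_width
      rw [h.1, Matrix.rank_one] at h1
      simpa using h1
    omega
  refine ⟨isSubmanifoldOfCodim_one_quadricCone hsymm hu, ?_, fun hd => ⟨?_, ?_⟩,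
    symAlg_quadricCone_eq hsymm hu hup hv, ?_, fun p q P R h => ?_⟩
  · rintro rfl
    refine ⟨?_, nCirc_quadricCone_two hsymm hu hne⟩
    rw [hstar]
    norm_num [Nat.choose]
  · exact nCirc_quadricCone_of_three_le hsymm hu (by omega) hup hv
  · rw [hstar, Nat.cast_sub (Nat.choose_pos (by omega)), Nat.cast_one]
  · obtain ⟨p, q, P, R, h⟩ := exists_isSylvesterForm hsymm hu
    exact ⟨p, q, P, R, h.pos_left hup, h.pos_right hv, h⟩
  · rw [symAlg_quadricCone_eq hsymm hu hup hv, h.skewAdjoint_sup_eq]
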